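/- Let $R$ be a commutative ring. A functor of $\mathcal R$-modules is a covariant functor $\mathbb M$ on commutative $R$-algebras $S$ such that $\mathbb M(S)$ is an $S$-module, naturally in $S$; a morphism is a natural transformation whose components are $S$-linear; limits and colimits are taken in the category of functors of $\mathcal R$-modules. Let $\mathcal R(S)=S$, and let $\mathbb M^*$ be the functor $\mathbb M^*(S)=\operatorname{Hom}_{\mathcal S}(\mathbb M_{|S},\mathcal R_{|S})$, where $_{|S}$ is restriction to commutative $S$-algebras. A functor of $\mathcal R$-modules is quasi-coherent if it is isomorphic to $S\mapsto N\otimes_R S$ for some $R$-module $N$, and pro-quasicoherent if it is isomorphic to an inverse limit, over a codirected index set, of quasi-coherent modules. It is essentially free if it is isomorphic to $\varprojlim_{\alpha\in P}\mathcal R^{(\alpha)}$, where $P$ is a set of subsets of some set $I$ closed under binary unions, $\mathcal R^{(\alpha)}=\bigoplus_\alpha\mathcal R$, and for $\alpha\subseteq\beta$ the transition map $\mathcal R^{(\beta)}\to\mathcal R^{(\alpha)}$ is restriction of coordinates. Theorem. Let $\mathbb M$ be an essentially free functor of $\mathcal R$-modules, and let $\{\mathbb M\to\mathcal M_i\}_i$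 be the family of all its quasi-coherent quotients (one for each subfunctor of $\mathcal R$-submodules $\mathbb K_i\subseteq\mathbb M$ such that $\mathcal M_i=\mathbb M/\mathbb K_i$ is quasi-coherent), with the canonical projections $\mathcal M_i\to\mathcal M_j$ for $\mathbb K_i\subseteq\mathbb K_j$ as transition maps. Then the index set, ordered by inclusion of the $\mathbb K_i$, is non-empty and codirected; the duals $\mathcal M_i^*\to\mathbb M^*$ of the projections exhibit $$\mathbb M^*=\varinjlim_i\mathcal M_i^*;$$ and the projections $\mathbb M\to\mathcal M_i$ exhibit $$\mathbb M=\varprojlim_i\mathcal M_i.$$ In particular, essentially free functors of $\mathcal R$-modules are pro-quasicoherent. -/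

import Mathlib

open CategoryTheory CategoryTheory.Limits
open scoped TensorProduct

universe u w w₁ w₂ w₃

/-- A functor of `𝓡`-modules: a covariant functor `M` on commutative `R`-algebras such that
`M(S)` is an `S`-module, with addition and scalar multiplication natural in `S`. -/
structure ModFunctor (R : Type u) [CommRing R] where
  obj : (S : Type u) → [CommRing S] → [Algebra R S] → Type w
  [addCommGroup : (S : Type u) → [CommRing S] → [Algebra R S] → AddCommGroup (obj S)]
  [module : (S : Type u) → [CommRing S] → [Algebra R S] → Module S (obj S)]
  map : {S T : Type u} → [CommRing S] → [Algebra R S] → [CommRing T] → [Algebra R T] →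
    (φ : S →ₐ[R] T) → obj S →ₛₗ[(φ : S →+* T)] obj T
  map_id : ∀ {S : Type u} [CommRing S] [Algebra R S] (x : obj S), map (AlgHom.id R S) x = x
  map_comp : ∀ {S T U : Type u} [CommRing S] [Algebra R S] [CommRing T] [Algebra R T]
    [CommRing U] [Algebra R U] (φ : S →ₐ[R] T) (ψ : T →ₐ[R] U) (x : obj S),
    map (ψ.comp φ) x = map ψ (map φ x)

namespace ModFunctor

attribute [instance] ModFunctor.addCommGroup ModFunctor.module

variable {R : Type u} [CommRing R]

/-- A morphism of functors of `𝓡`-modules. -/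
@[ext]
structure Hom (M : ModFunctor.{u, w₁} R) (N : ModFunctor.{u, w₂} R) where
  app : (S : Type u) → [CommRing S] → [Algebra R S] → M.obj S →ₗ[S] N.obj S
  naturality : ∀ {S T : Type u} [CommRing S] [Algebra R S] [CommRing T] [Algebra R T]
    (φ : S →ₐ[R] T) (x : M.obj S), app T (M.map φ x) = N.map φ (app S x)

/-- Composition of morphisms. -/
def Hom.comp {M : ModFunctor.{u, w₁} R} {N : ModFunctor.{u, w₂} R} {P : ModFunctor.{u, w₃} R}
    (f : Hom M N) (g : Hom N P) : Hom M P where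
  app S _ _ := (g.app S).comp (f.app S)
  naturality φ x := by simp [f.naturality, g.naturality]

/-- The category of functors of `𝓡`-modules (with values in `Type w`). -/
instance : Category (ModFunctor.{u, w} R) where
  Hom M N := Hom M N
  id M := { app := fun S _ _ => LinearMap.id, naturality := fun _ _ => rfl }
  comp f g := Hom.comp f g

/-- A morphism is an isomorphism if it is bijective on every commutative `R`-algebra. (It is
formulated for functors with values in possibly different universes.) -/
def Hom.IsIsomorphism {M : ModFunctor.{u, w₁} R} {N : ModFunctor.{u, w₂} R} (f : Hom M N) : Prop :=
  ∀ (S : Type u) [CommRing S] [Algebra R S], Function.Bijective (f.app S)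

/-! ### Basic examples -/

variable (R) in
/-- The functor `𝓡`, with `𝓡(S) = S`. -/
def ring : ModFunctor.{u, u} R where
  obj S _ _ := S
  addCommGroup S _ _ := inferInstanceAs (AddCommGroup S)
  module S _ _ := inferInstanceAs (Module S S)
  map φ := { toFun := φ, map_add' := map_add φ, map_smul' := by simp }
  map_id _ := rfl
  map_comp _ _ _ := rfl

/-- The quasi-coherent module `S ↦ S ⊗[R] N` associated with an `R`-module `N`. -/
def quasiCoherent (N : Type u) [AddCommGroup N] [Module R N] : ModFunctor.{u, u} R where
  obj S _ _ := S ⊗[R] N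
  addCommGroup S _ _ := inferInstanceAs (AddCommGroup (S ⊗[R] N))
  module S _ _ := inferInstanceAs (Module S (S ⊗[R] N))
  map φ :=
    { toFun := LinearMap.rTensor N φ.toLinearMap
      map_add' := map_add _
      map_smul' := fun s x => by
        induction x using TensorProduct.induction_on with
        | zero => simp
        | tmul a n => simp [TensorProduct.smul_tmul']
        | add x y hx hy => simp only [smul_add, map_add, hx, hy] }
  map_id x := by
    change LinearMap.rTensor N (AlgHom.id R _).toLinearMap x = x
    simp
  map_comp φ ψ x := by
    change LinearMap.rTensor N (ψ.comp φ).toLinearMap x =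
      LinearMap.rTensor N ψ.toLinearMap (LinearMap.rTensor N φ.toLinearMap x)
    simp [LinearMap.rTensor_comp]

/-- `M` is quasi-coherent if it is isomorphic to the quasi-coherent module associated with some
`R`-module. -/
def IsQuasiCoherent (M : ModFunctor.{u, w} R) : Prop :=
  ∃ (N : Type u) (_ : AddCommGroup N) (_ : Module R N) (f : Hom (quasiCoherent (R := R) N) M),
    f.IsIsomorphism

/-! ### Essentially free functors -/

/-- For a set `P` of subsets of `I`, the `S`-module `lim_{α ∈ P} S^(α)` of compatible families,
where for `α ⊆ β` the transition map `S^(β) → S^(α)` of the finite-support modules is restriction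
of coordinates. -/
def limFreeObj {I : Type u} (P : Set (Set I)) (S : Type u) [CommRing S] :
    Submodule S ((α : P) → (α.1 →₀ S)) where
  carrier := {x | ∀ (α β : P) (h : α.1 ⊆ β.1) (i : α.1), x β (Set.inclusion h i) = x α i}
  add_mem' hx hy α β h i := by simp [hx α β h i, hy α β h i]
  zero_mem' α β h i := by simp
  smul_mem' s x hx α β h i := by simp [hx α β h i]

variable (R) in
/-- The functor `lim_{α ∈ P} 𝓡^(α)`. -/
noncomputable def limFree {I : Type u} (P : Set (Set I)) : ModFunctor.{u, u} R where
  obj S _ _ := limFreeObj P S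
  addCommGroup S _ _ := inferInstanceAs (AddCommGroup (limFreeObj P S))
  module S _ _ := inferInstanceAs (Module S (limFreeObj P S))
  map φ :=
    { toFun := fun x => ⟨fun α => (x.1 α).mapRange φ (map_zero φ), fun α β h i => by
        simp [x.2 α β h i]⟩
      map_add' := fun x y => by ext α i; simp
      map_smul' := fun s x => by ext α i; simp }
  map_id x := by ext α i; rfl
  map_comp φ ψ x := by ext α i; simp

/-- `M` is essentially free if it is isomorphic to `lim_{α ∈ P} 𝓡^(α)` for a set `P` of subsets
of a set `I` that is closed under binary unions. -/
def IsEssentiallyFree (M : ModFunctor.{u, w} R) : Prop :=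
  ∃ (I : Type u) (P : Set (Set I)), (∀ α ∈ P, ∀ β ∈ P, α ∪ β ∈ P) ∧
    ∃ f : Hom (limFree R P) M, f.IsIsomorphism

/-! ### Internal homomorphisms and duals -/

/-- The elements of `ℍom(M, N)(S) = Hom_𝓢(M|_S, N|_S)`. A commutative `S`-algebra is given as a
commutative `R`-algebra `T` with a morphism of `R`-algebras `φ : S → T`, and a morphism of
`S`-algebras `(T, φ) → (T', φ')` as a morphism of `R`-algebras `ψ` such that `φ' = ψ ∘ φ`. -/
@[ext]
structure IHom (M : ModFunctor.{u, w₁} R) (N : ModFunctor.{u, w₂} R)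
    (S : Type u) [CommRing S] [Algebra R S] where
  app : (T : Type u) → [CommRing T] → [Algebra R T] → (φ : S →ₐ[R] T) → M.obj T →ₗ[T] N.obj T
  naturality : ∀ {T T' : Type u} [CommRing T] [Algebra R T] [CommRing T'] [Algebra R T']
    (φ : S →ₐ[R] T) (ψ : T →ₐ[R] T') (x : M.obj T),
    app T' (ψ.comp φ) (M.map ψ x) = N.map ψ (app T φ x)

namespace IHom

variable {M : ModFunctor.{u, w₁} R} {N : ModFunctor.{u, w₂} R}
  {S : Type u} [CommRing S] [Algebra R S]

instance : Zero (IHom M N S) :=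
  ⟨{ app := fun _ _ _ _ => 0, naturality := by simp }⟩

instance : Add (IHom M N S) :=
  ⟨fun f g => { app := fun T _ _ φ => f.app T φ + g.app T φ
                naturality := by simp [f.naturality, g.naturality] }⟩

instance : Neg (IHom M N S) :=
  ⟨fun f => { app := fun T _ _ φ => -f.app T φ
              naturality := by simp [f.naturality] }⟩

instance : SMul S (IHom M N S) :=
  ⟨fun s f => { app := fun T _ _ φ => φ s • f.app T φ
                naturality := by simp [f.naturality] }⟩

instance : AddCommGroup (IHom M N S) where
  add_assoc f g h := IHom.ext (by funext T _ _ φ; exact add_assoc _ _ _)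
  zero_add f := IHom.ext (by funext T _ _ φ; exact zero_add _)
  add_zero f := IHom.ext (by funext T _ _ φ; exact add_zero _)
  neg_add_cancel f := IHom.ext (by funext T _ _ φ; exact neg_add_cancel _)
  add_comm f g := IHom.ext (by funext T _ _ φ; exact add_comm _ _)
  nsmul := nsmulRec
  zsmul := zsmulRec

instance : Module S (IHom M N S) where
  one_smul f := IHom.ext (by
    funext T _ _ φ; change φ 1 • f.app T φ = f.app T φ; simp)
  mul_smul s t f := IHom.ext (by
    funext T _ _ φ; change φ (s * t) • f.app T φ = φ s • φ t • f.app T φ; simp [mul_smul])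
  smul_zero s := IHom.ext (by funext T _ _ φ; exact smul_zero _)
  smul_add s f g := IHom.ext (by funext T _ _ φ; exact smul_add _ _ _)
  add_smul s t f := IHom.ext (by
    funext T _ _ φ
    change φ (s + t) • f.app T φ = φ s • f.app T φ + φ t • f.app T φ
    simp [add_smul])
  zero_smul f := IHom.ext (by
    funext T _ _ φ; change φ 0 • f.app T φ = 0; simp)

end IHom

/-- The functor `ℍom(M, N)`; for `S → S'` the map `ℍom(M, N)(S) → ℍom(M, N)(S')` is restriction
from `S`-algebras to `S'`-algebras. -/
def ihom (M : ModFunctor.{u, w₁} R) (N : ModFunctor.{u, w₂} R) :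
    ModFunctor.{u, max (u + 1) w₁ w₂} R where
  obj S _ _ := IHom M N S
  map g :=
    { toFun := fun f =>
        { app := fun T _ _ φ => f.app T (φ.comp g)
          naturality := fun φ ψ x => f.naturality (φ.comp g) ψ x }
      map_add' := fun _ _ => rfl
      map_smul' := fun _ _ => rfl }
  map_id _ := rfl
  map_comp _ _ _ := rfl

/-- The dual `M^* = ℍom(M, 𝓡)`. -/
def dual (M : ModFunctor.{u, w} R) : ModFunctor.{u, max (u + 1) w} R :=
  ihom M (ring R)

variable (R) in
/-- The contravariant functor `M ↦ M^*`, acting on morphisms by precomposition. -/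
def dualFunctor : (ModFunctor.{u, w} R)ᵒᵖ ⥤ ModFunctor.{u, max (u + 1) w} R where
  obj M := dual M.unop
  map h :=
    { app := fun _ _ _ =>
        { toFun := fun f =>
            { app := fun T _ _ φ => (f.app T φ).comp (Hom.app h.unop T)
              naturality := fun φ ψ x =>
                (congrArg _ (Hom.naturality h.unop ψ x)).trans
                  (f.naturality φ ψ (Hom.app h.unop _ x)) }
          map_add' := fun _ _ => rfl
          map_smul' := fun _ _ => rfl }
      naturality := fun _ _ => rfl }
  map_id _ := rfl
  map_comp _ _ := rfl

/-! ### Quasi-coherent quotients -/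

/-- A subfunctor of `𝓡`-submodules of `M`. -/
@[ext]
structure Sub (M : ModFunctor.{u, w} R) where
  obj : (S : Type u) → [CommRing S] → [Algebra R S] → Submodule S (M.obj S)
  map_mem : ∀ {S T : Type u} [CommRing S] [Algebra R S] [CommRing T] [Algebra R T]
    (φ : S →ₐ[R] T) {x : M.obj S}, x ∈ obj S → M.map φ x ∈ obj T

instance (M : ModFunctor.{u, w} R) : PartialOrder (Sub M) where
  le K L := ∀ (S : Type u) [CommRing S] [Algebra R S], K.obj S ≤ L.obj S
  le_refl K S _ _ := le_rfl
  le_trans K L N h h' S _ _ := (h S).trans (h' S)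
  le_antisymm K L h h' := Sub.ext (by funext S _ _; exact le_antisymm (h S) (h' S))

/-- The quotient functor `S ↦ M(S) / K(S)`. -/
def quot (M : ModFunctor.{u, w} R) (K : Sub M) : ModFunctor.{u, w} R where
  obj S _ _ := M.obj S ⧸ K.obj S
  map φ := Submodule.mapQ _ _ (M.map φ) (fun _ hx => K.map_mem φ hx)
  map_id x := by
    induction x using Submodule.Quotient.induction_on with
    | H x => exact congrArg Submodule.Quotient.mk (M.map_id x)
  map_comp φ ψ x := by
    induction x using Submodule.Quotient.induction_on with
    | H x => exact congrArg Submodule.Quotient.mk (M.map_comp φ ψ x)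

/-- The set of quasi-coherent quotients of `M`. Quotients of `M` are identified with their
kernels, that is, with the subfunctors `K` of `M`; the order is inclusion of kernels, so that
`K ≤ L` means that the quotient `M / L` is a further quotient of `M / K`. -/
abbrev QCQuotient (M : ModFunctor.{u, w} R) : Type (max (u + 1) w) :=
  {K : Sub M // (M.quot K).IsQuasiCoherent}

/-- The inverse system of the quasi-coherent quotients `M / K` of `M`, with the canonical
projections `M / K → M / L` for `K ≤ L`. -/
def quotSystem (M : ModFunctor.{u, w} R) : QCQuotient M ⥤ ModFunctor.{u, w} R where
  obj K := M.quot K.1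
  map {K L} h :=
    { app := fun S _ _ => Submodule.mapQ _ _ LinearMap.id (leOfHom h S)
      naturality := fun φ x => by
        induction x using Submodule.Quotient.induction_on with
        | H x => rfl }
  map_id K := by
    refine Hom.ext ?_
    funext S _ _
    exact Submodule.mapQ_id _
  map_comp {K L N} h h' := by
    refine Hom.ext ?_
    funext S _ _
    refine LinearMap.ext fun x => ?_
    induction x using Submodule.Quotient.induction_on with
    | H x => rfl

/-- The projections `M → M / K`, as a cone over the inverse system of quasi-coherent quotients. -/
def quotCone (M : ModFunctor.{u, w} R) : Cone M.quotSystem where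
  pt := M
  π :=
    { app := fun K =>
        { app := fun S _ _ => (K.1.obj S).mkQ
          naturality := fun _ _ => rfl }
      naturality := fun _ _ _ => rfl }

/-- `M` is pro-quasicoherent if it is isomorphic to an inverse limit (over a small codirected
index set) of quasi-coherent modules. -/
def IsProQuasicoherent (M : ModFunctor.{u, w} R) : Prop :=
  ∃ (J : Type u) (_ : Preorder J) (_ : IsCofiltered J) (F : J ⥤ ModFunctor.{u, u} R) (c : Cone F),
    (∀ j, (F.obj j).IsQuasiCoherent) ∧ Nonempty (IsLimit c) ∧ ∃ f : Hom c.pt M, f.IsIsomorphism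

end ModFunctor

/-! An essentially free functor has coordinates: `M(S)` is the module of functions `I → S` whose
support meets every member of `P` in a finite set. Call `γ ⊆ I` admissible if all elements of `M`
have finite support on `γ`. Restricting coordinates to such a `γ` gives a quotient naturally
isomorphic to `S ↦ S^(γ)`, hence quasi-coherent.

The key fact (`exists_admissible_app_eq_zero`) is that any homomorphism `g` from `M` to `𝓡` or to a
quasi-coherent module factors through some admissible `γ`. Evaluate `g` on a generic element whose
coordinates are polynomial variables: the value involves only finitely many of them, and by
specialization `g` depends on only finitely many coordinates among elements with a bounded support.
Then `γ = {i | g(e_i) ≠ 0}` works.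

Applied to projections `M → M / K`, this makes the admissible quotients cofinal; applied to
functionals, it shows that each one comes from a quasi-coherent quotient, which gives the colimit.
For the limit, singletons recover the coordinates of a compatible family, and admissibility of the
members of `P` gives the finiteness of supports. -/

namespace ModFunctor

variable {R : Type u} [CommRing R]

/-! ### Killing all but finitely many variables -/

open Classical in
variable (R) in
/-- The endomorphism of a polynomial ring that kills the variables outside `J`. -/
noncomputable def truncate {I : Type u} (S : Type u) [CommRing S] [Algebra R S] (J : Finset I) :
    MvPolynomial I S →ₐ[R] MvPolynomial I S :=
  MvPolynomial.aevalTower (IsScalarTower.toAlgHom R S (MvPolynomial I S))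
    (fun i => if i ∈ J then MvPolynomial.X i else 0)

open Classical in
lemma truncate_X {I : Type u} (S : Type u) [CommRing S] [Algebra R S] (J : Finset I) (i : I) :
    truncate R S J (MvPolynomial.X i) = if i ∈ J then MvPolynomial.X i else 0 :=
  MvPolynomial.aevalTower_X _ _ _

lemma truncate_C {I : Type u} (S : Type u) [CommRing S] [Algebra R S] (J : Finset I) (s : S) :
    truncate R S J (MvPolynomial.C s) = MvPolynomial.C s :=
  MvPolynomial.aevalTower_C _ _ _

lemma truncate_eq_self {I : Type u} (S : Type u) [CommRing S] [Algebra R S] (J : Finset I)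
    (p : MvPolynomial I S) (h : p.vars ⊆ J) : truncate R S J p = p := by
  refine MvPolynomial.hom_congr_vars (f₁ := (truncate R S J).toRingHom) (f₂ := RingHom.id _)
    ?_ ?_ rfl
  · ext s : 1
    exact truncate_C S J s
  · intro i hi _
    exact (truncate_X S J i).trans (if_pos (h hi))

/-- A functor of modules is finitary if each of its elements over a polynomial ring involves
finitely many of the variables only. -/
def Finitary (N : ModFunctor.{u, w} R) : Prop :=
  ∀ (S : Type u) [CommRing S] [Algebra R S] (I : Type u) (z : N.obj (MvPolynomial I S)),
    ∃ J : Finset I, N.map (truncate R S J) z = z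

variable (R) in
lemma finitary_ring : (ring R).Finitary :=
  fun S _ _ _ z => ⟨MvPolynomial.vars z, truncate_eq_self S _ z subset_rfl⟩

lemma finitary_quasiCoherent (N : Type u) [AddCommGroup N] [Module R N] :
    (quasiCoherent (R := R) N).Finitary := by
  classical
  intro S _ _ I z
  -- Asking for all larger `J'` lets the induction pass to sums by taking unions.
  suffices h : ∃ J : Finset I, ∀ J', J ⊆ J' →
      LinearMap.rTensor N (truncate R S J').toLinearMap z = z from
    h.imp fun J hJ => hJ J subset_rfl
  change MvPolynomial I S ⊗[R] N at z
  induction z using TensorProduct.induction_on with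
  | zero => exact ⟨∅, fun _ _ => map_zero _⟩
  | tmul p n =>
    refine ⟨p.vars, fun J' h => ?_⟩
    rw [LinearMap.rTensor_tmul, AlgHom.toLinearMap_apply, truncate_eq_self S J' p h]
  | add x y hx hy =>
    obtain ⟨J₁, h₁⟩ := hx
    obtain ⟨J₂, h₂⟩ := hy
    refine ⟨J₁ ∪ J₂, fun J' h => ?_⟩
    rw [map_add, h₁ J' (Finset.union_subset_left h), h₂ J' (Finset.union_subset_right h)]

lemma IsQuasiCoherent.finitary {N : ModFunctor.{u, w} R} (hN : N.IsQuasiCoherent) :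
    N.Finitary := by
  obtain ⟨N', _, _, f, hf⟩ := hN
  intro S _ _ I z
  obtain ⟨z, rfl⟩ := (hf _).2 z
  obtain ⟨J, hJ⟩ := finitary_quasiCoherent N' S I z
  exact ⟨J, by rw [← f.naturality, hJ]⟩

/-! ### Functors of modules with coordinates -/

/-- Coordinates on `M`: an identification of `M(S)`, naturally in `S`, with the module of those
functions `I → S` that have finite support on each member of a family `P` of subsets of `I`. -/
structure Coordinates (M : ModFunctor.{u, w} R) (I : Type u) (P : Set (Set I)) where
  coord : (S : Type u) → [CommRing S] → [Algebra R S] → M.obj S →ₗ[S] (I → S)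
  coord_map : ∀ {S T : Type u} [CommRing S] [Algebra R S] [CommRing T] [Algebra R T]
    (φ : S →ₐ[R] T) (x : M.obj S) (i : I), coord T (M.map φ x) i = φ (coord S x i)
  injective : ∀ (S : Type u) [CommRing S] [Algebra R S], Function.Injective (coord S)
  finite : ∀ {S : Type u} [CommRing S] [Algebra R S] (x : M.obj S), ∀ α ∈ P,
    (α ∩ Function.support (coord S x)).Finite
  exists_coord_eq : ∀ {S : Type u} [CommRing S] [Algebra R S] (y : I → S),
    (∀ α ∈ P, (α ∩ Function.support y).Finite) → ∃ x, coord S x = y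

/-- Transport of coordinates along an isomorphism. -/
noncomputable def Coordinates.ofIsIsomorphism {M : ModFunctor.{u, w₁} R}
    {N : ModFunctor.{u, w₂} R} {I : Type u} {P : Set (Set I)} (c : Coordinates M I P)
    (f : Hom M N) (hf : f.IsIsomorphism) : Coordinates N I P where
  coord S _ _ := (c.coord S).comp (LinearEquiv.ofBijective (f.app S) (hf S)).symm.toLinearMap
  coord_map {S T} _ _ _ _ φ y i := by
    obtain ⟨x, rfl⟩ := (LinearEquiv.ofBijective (f.app S) (hf S)).surjective y
    have h : N.map φ (LinearEquiv.ofBijective (f.app S) (hf S) x) =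
        LinearEquiv.ofBijective (f.app T) (hf T) (M.map φ x) := (f.naturality φ x).symm
    rw [h]
    simp [c.coord_map]
  injective S _ _ := (c.injective S).comp (LinearEquiv.injective _)
  finite x α hα := c.finite _ α hα
  exists_coord_eq {S} _ _ y hy := by
    obtain ⟨x, rfl⟩ := c.exists_coord_eq y hy
    exact ⟨f.app S x, congrArg (c.coord S)
      ((LinearEquiv.ofBijective (f.app S) (hf S)).symm_apply_apply x)⟩

/-- Both values are compared with the component at `α ∪ β`; this is where closure of `P` under
unions enters. It makes the arbitrary choice of a member of `P` in `limFreeCoordinates` harmless. -/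
lemma limFreeObj_apply_eq {I : Type u} {P : Set (Set I)} (hP : ∀ α ∈ P, ∀ β ∈ P, α ∪ β ∈ P)
    {S : Type u} [CommRing S] (x : limFreeObj P S) (α β : P) (i : I) (hα : i ∈ α.1)
    (hβ : i ∈ β.1) : x.1 α ⟨i, hα⟩ = x.1 β ⟨i, hβ⟩ := by
  have h₁ := x.2 α ⟨α.1 ∪ β.1, hP _ α.2 _ β.2⟩ Set.subset_union_left ⟨i, hα⟩
  have h₂ := x.2 β ⟨α.1 ∪ β.1, hP _ α.2 _ β.2⟩ Set.subset_union_right ⟨i, hβ⟩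
  exact h₁.symm.trans h₂

variable (R) in
/-- The coordinates of `lim_{α ∈ P} 𝓡^(α)`, indexed by the union of `P`. -/
noncomputable def limFreeCoordinates {I : Type u} (P : Set (Set I))
    (hP : ∀ α ∈ P, ∀ β ∈ P, α ∪ β ∈ P) :
    Coordinates (limFree R P) {i : I // ∃ α ∈ P, i ∈ α}
      ((fun α => Subtype.val ⁻¹' α) '' P) where
  coord S _ _ :=
    { toFun := fun (x : limFreeObj P S) i =>
        x.1 ⟨i.2.choose, i.2.choose_spec.1⟩ ⟨i.1, i.2.choose_spec.2⟩
      map_add' := fun _ _ => rfl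
      map_smul' := fun _ _ => rfl }
  coord_map φ x i := rfl
  injective S _ _ := by
    intro (x : limFreeObj P S) (y : limFreeObj P S) h
    refine Subtype.ext (funext fun α => Finsupp.ext fun i => ?_)
    have hi : ∃ β ∈ P, i.1 ∈ β := ⟨α.1, α.2, i.2⟩
    have h' := congrFun h ⟨i.1, hi⟩
    exact (limFreeObj_apply_eq hP x α ⟨_, hi.choose_spec.1⟩ i.1 i.2 hi.choose_spec.2).trans
      (h'.trans
        (limFreeObj_apply_eq hP y α ⟨_, hi.choose_spec.1⟩ i.1 i.2 hi.choose_spec.2).symm)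
  finite {S} _ _ x := by
    change limFreeObj P S at x
    rintro _ ⟨α, hα, rfl⟩
    have hfin := ((x.1 ⟨α, hα⟩).hasFiniteSupport.image (Subtype.val : α → I)).preimage
      (f := (Subtype.val : {i : I // ∃ α ∈ P, i ∈ α} → I)) Subtype.val_injective.injOn
    refine hfin.subset fun i hi => ?_
    refine ⟨⟨i.1, hi.1⟩, fun h => hi.2 ?_, rfl⟩
    exact (limFreeObj_apply_eq hP x _ ⟨α, hα⟩ i.1 i.2.choose_spec.2 hi.1).trans h
  exists_coord_eq {S} _ _ y hy := by
    have hfin (α : P) : (Function.support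
        fun i : α.1 => y ⟨i.1, α.1, α.2, i.2⟩).Finite := by
      refine ((hy _ ⟨α.1, α.2, rfl⟩).preimage
        (f := fun i : α.1 => (⟨i.1, α.1, α.2, i.2⟩ : {i : I // ∃ α ∈ P, i ∈ α})) ?_).subset ?_
      · intro i _ j _ h
        exact Subtype.ext (congrArg (fun k => k.1) h)
      · intro i hi
        exact ⟨i.2, hi⟩
    exact ⟨(⟨fun α => Finsupp.ofSupportFinite _ (hfin α), fun α β h i => rfl⟩ : limFreeObj P S),
      rfl⟩

/-! ### Admissible sets of indices and homomorphisms to finitary functors -/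

namespace Coordinates

variable {M : ModFunctor.{u, w} R} {I : Type u} {P : Set (Set I)} (c : Coordinates M I P)

/-- A set of indices is admissible if every element of `M` has finite support on it. -/
def Admissible (γ : Set I) : Prop :=
  ∀ (S : Type u) [CommRing S] [Algebra R S] (x : M.obj S),
    (γ ∩ Function.support (c.coord S x)).Finite

lemma admissible_of_mem {α : Set I} (hα : α ∈ P) : c.Admissible α :=
  fun _ _ _ x => c.finite x α hα

lemma admissible_of_finite {γ : Set I} (hγ : γ.Finite) : c.Admissible γ :=
  fun _ _ _ _ => hγ.inter_of_left _

variable {c} in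
lemma Admissible.union {γ δ : Set I} (hγ : c.Admissible γ) (hδ : c.Admissible δ) :
    c.Admissible (γ ∪ δ) := fun S _ _ x => by
  rw [Set.union_inter_distrib_right]
  exact (hγ S x).union (hδ S x)

lemma exists_coord_eq_of_finite {S : Type u} [CommRing S] [Algebra R S] (y : I → S)
    (hy : (Function.support y).Finite) : ∃ x, c.coord S x = y :=
  c.exists_coord_eq y fun _ _ => hy.inter_of_right _

/-- Membership in `M` is a condition on supports only, so the base ring may change; this is what
allows generic elements over polynomial rings. -/
lemma exists_coord_eq_of_support_subset {S T : Type u} [CommRing S] [Algebra R S] [CommRing T]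
    [Algebra R T] (x : M.obj S) (y : I → T)
    (hy : Function.support y ⊆ Function.support (c.coord S x)) : ∃ x', c.coord T x' = y :=
  c.exists_coord_eq y fun α hα => (c.finite x α hα).subset (Set.inter_subset_inter_right _ hy)

open Classical in
/-- The element of `M(S)` with `i`-th coordinate `1` and the other coordinates `0`. -/
noncomputable def basisVector (S : Type u) [CommRing S] [Algebra R S] (i : I) : M.obj S :=
  (c.exists_coord_eq_of_finite (Pi.single i (1 : S))
    ((Set.finite_singleton i).subset Pi.support_single_subset)).choose

open Classical in
lemma coord_basisVector (S : Type u) [CommRing S] [Algebra R S] (i : I) :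
    c.coord S (c.basisVector S i) = Pi.single i (1 : S) :=
  (c.exists_coord_eq_of_finite (Pi.single i (1 : S))
    ((Set.finite_singleton i).subset Pi.support_single_subset)).choose_spec

lemma map_basisVector {S T : Type u} [CommRing S] [Algebra R S] [CommRing T] [Algebra R T]
    (φ : S →ₐ[R] T) (i : I) : M.map φ (c.basisVector S i) = c.basisVector T i := by
  classical
  refine c.injective T (funext fun j => ?_)
  rw [c.coord_map, coord_basisVector, coord_basisVector]
  by_cases h : j = i
  · subst h; simp
  · simp [h]

variable {N : ModFunctor.{u, w₂} R} {S : Type u} [CommRing S] [Algebra R S]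

/-- On elements supported in the support of a given element, a homomorphism to a finitary functor
depends on finitely many coordinates only. -/
lemma exists_finset_app_eq_zero (hN : N.Finitary) (g : IHom M N S) {T₀ : Type u} [CommRing T₀]
    [Algebra R T₀] (x : M.obj T₀) :
    ∃ J : Finset I, ∀ (T : Type u) [CommRing T] [Algebra R T] (φ : S →ₐ[R] T) (y : M.obj T),
      Function.support (c.coord T y) ⊆ Function.support (c.coord T₀ x) →
      (∀ i ∈ J, c.coord T y i = 0) → g.app T φ y = 0 := by
  classical
  -- The generic element: an independent variable at each index in the support of `x`, zero
  -- elsewhere.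
  obtain ⟨ξ, hξ⟩ := c.exists_coord_eq_of_support_subset x
    (fun i => if c.coord T₀ x i = 0 then 0 else (MvPolynomial.X i : MvPolynomial I S))
    (fun i hi h => hi (if_pos h))
  let ι : S →ₐ[R] MvPolynomial I S := IsScalarTower.toAlgHom R S (MvPolynomial I S)
  obtain ⟨J, hJ⟩ := hN S I (g.app _ ι ξ)
  refine ⟨J, fun T _ _ φ y hy hyJ => ?_⟩
  -- Specializing `X i` to the `i`-th coordinate of `y` carries `ξ` to `y`.
  let ev : MvPolynomial I S →ₐ[R] T := MvPolynomial.aevalTower φ (c.coord T y)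
  have hevX (i : I) : ev (MvPolynomial.X i) = c.coord T y i := MvPolynomial.aevalTower_X _ _ _
  have hev : ev.comp ι = φ := AlgHom.ext fun s => MvPolynomial.aevalTower_C _ _ s
  have hξy : M.map ev ξ = y := by
    refine c.injective T (funext fun i => ?_)
    rw [c.coord_map, hξ]
    dsimp only
    split_ifs with h
    · rw [map_zero]
      by_contra h'
      exact hy (fun h'' => h' h''.symm) h
    · exact hevX i
  -- Variables outside `J` are killed by truncation, those in `J` by the vanishing of the
  -- coordinates of `y`.
  have hξ0 : M.map (ev.comp (truncate R S J)) ξ = 0 := by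
    refine c.injective T (funext fun i => ?_)
    rw [c.coord_map, hξ, map_zero]
    dsimp only
    split_ifs with h
    · simp
    · rw [AlgHom.comp_apply, truncate_X]
      split_ifs with hi
      · rw [hevX, hyJ i hi]; rfl
      · simp
  calc g.app T φ y = g.app T (ev.comp ι) (M.map ev ξ) := by rw [hev, hξy]
    _ = N.map ev (N.map (truncate R S J) (g.app _ ι ξ)) := by rw [g.naturality, hJ]
    _ = g.app T ((ev.comp (truncate R S J)).comp ι) (M.map (ev.comp (truncate R S J)) ξ) := by
      rw [g.naturality, N.map_comp]
    _ = 0 := by rw [hξ0, map_zero]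

/-- A homomorphism from `M` to a finitary functor factors through the restriction to an admissible
set of coordinates. -/
theorem exists_admissible_app_eq_zero (hN : N.Finitary) (g : IHom M N S) :
    ∃ γ : Set I, c.Admissible γ ∧ ∀ (T : Type u) [CommRing T] [Algebra R T] (φ : S →ₐ[R] T)
      (y : M.obj T), (∀ i ∈ γ, c.coord T y i = 0) → g.app T φ y = 0 := by
  classical
  have hbasis {T : Type u} [CommRing T] [Algebra R T] (φ : S →ₐ[R] T) (i : I) :
      g.app T φ (c.basisVector T i) = N.map φ (g.app S (AlgHom.id R S) (c.basisVector S i)) := by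
    rw [← g.naturality, map_basisVector, AlgHom.comp_id]
  refine ⟨{i | g.app S (AlgHom.id R S) (c.basisVector S i) ≠ 0}, ?_, ?_⟩
  · intro T _ _ x
    -- For `i` in the support of `x` but outside `J`, the basis vector `e_i` is supported in that
    -- support and vanishes on `J`, so `g(e_i) = 0`. Thus `γ` meets the support of `x` inside `J`.
    obtain ⟨J, hJ⟩ := c.exists_finset_app_eq_zero hN g x
    refine J.finite_toSet.subset fun i hi => ?_
    by_contra hiJ
    refine hi.1 (hJ S _ _ ?_ ?_)
    · rw [coord_basisVector]
      refine Pi.support_single_subset.trans ?_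
      rintro _ rfl
      exact hi.2
    · intro j hj
      rw [coord_basisVector]
      exact Pi.single_eq_of_ne (by rintro rfl; exact hiJ hj) _
  · intro T _ _ φ y hy
    obtain ⟨J, hJ⟩ := c.exists_finset_app_eq_zero hN g y
    -- Here `z` is the part of `y` on `J`. The choice of `J` gives `g(y - z) = 0`, and every term of
    -- `g(z)` vanishes since `g(e_i) = 0` or `y_i = 0`.
    let z : M.obj T := ∑ i ∈ J, c.coord T y i • c.basisVector T i
    have hz (j : I) : c.coord T z j = if j ∈ J then c.coord T y j else 0 := by
      simp only [z, map_sum, map_smul, coord_basisVector, Finset.sum_apply, Pi.smul_apply,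
        Pi.single_apply, smul_eq_mul, mul_ite, mul_one, mul_zero, Finset.sum_ite_eq]
    have hyz : g.app T φ (y - z) = 0 := by
      refine hJ T φ _ (fun i hi h => hi ?_) fun i hi => ?_
      · rw [map_sub, Pi.sub_apply, hz, h, ite_self, sub_zero]
      · rw [map_sub, Pi.sub_apply, hz, if_pos hi, sub_self]
    have hz0 : g.app T φ z = 0 := by
      rw [map_sum]
      refine Finset.sum_eq_zero fun i _ => ?_
      rw [map_smul, hbasis]
      by_cases h : g.app S (AlgHom.id R S) (c.basisVector S i) = 0
      · rw [h, map_zero, smul_zero]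
      · rw [hy i h, zero_smul]
    rw [map_sub, hz0, sub_zero] at hyz
    exact hyz

/-! ### Quotients obtained by restricting coordinates -/

/-- The subfunctor of the elements whose coordinates in `γ` vanish. -/
def vanishing (γ : Set I) : Sub M where
  obj S _ _ :=
    { carrier := {x | ∀ i ∈ γ, c.coord S x i = 0}
      add_mem' := fun hx hy i hi => by rw [map_add, Pi.add_apply, hx i hi, hy i hi, add_zero]
      zero_mem' := fun i _ => by rw [map_zero, Pi.zero_apply]
      smul_mem' := fun s x hx i hi => by rw [map_smul, Pi.smul_apply, hx i hi, smul_zero] }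
  map_mem φ x hx i hi := by rw [c.coord_map, hx i hi, map_zero]

lemma mem_vanishing {γ : Set I} {x : M.obj S} :
    x ∈ (c.vanishing γ).obj S ↔ ∀ i ∈ γ, c.coord S x i = 0 := Iff.rfl

lemma vanishing_anti {γ δ : Set I} (h : γ ⊆ δ) : c.vanishing δ ≤ c.vanishing γ :=
  fun _ _ _ _ hx i hi => hx i (h hi)

variable {c} in
/-- Restriction of the coordinates to an admissible set. -/
noncomputable def Admissible.restrict {γ : Set I} (hγ : c.Admissible γ)
    (S : Type u) [CommRing S] [Algebra R S] : M.obj S →ₗ[S] (γ →₀ S) where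
  toFun x := Finsupp.ofSupportFinite (fun i : γ => c.coord S x i)
    (((hγ S x).preimage Subtype.val_injective.injOn).subset fun i hi => ⟨i.2, hi⟩)
  map_add' x y := Finsupp.ext fun i => congrFun (map_add (c.coord S) x y) i
  map_smul' s x := Finsupp.ext fun i => congrFun (map_smul (c.coord S) s x) i

variable {c} in
lemma Admissible.restrict_surjective {γ : Set I} (hγ : c.Admissible γ) (S : Type u) [CommRing S]
    [Algebra R S] : Function.Surjective (hγ.restrict S) := by
  classical
  intro y
  obtain ⟨x, hx⟩ := c.exists_coord_eq_of_finite (fun i => if h : i ∈ γ then y ⟨i, h⟩ else 0)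
    ((y.hasFiniteSupport.image Subtype.val).subset fun i hi => by
      by_cases h : i ∈ γ
      · exact ⟨⟨i, h⟩, by simpa [h] using hi, rfl⟩
      · simp [h] at hi)
  refine ⟨x, Finsupp.ext fun i => ?_⟩
  change c.coord S x i = y i
  rw [hx]
  exact dif_pos i.2

variable {c} in
lemma Admissible.ker_restrict {γ : Set I} (hγ : c.Admissible γ) (S : Type u) [CommRing S]
    [Algebra R S] : (c.vanishing γ).obj S = LinearMap.ker (hγ.restrict S) := by
  ext x
  rw [LinearMap.mem_ker, mem_vanishing]
  exact ⟨fun h => Finsupp.ext fun i => h i i.2, fun h i hi => DFunLike.congr_fun h ⟨i, hi⟩⟩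

end Coordinates

open Classical in
lemma finsuppScalarRight_rTensor {ι S T : Type u} [CommRing S] [Algebra R S] [CommRing T]
    [Algebra R T] (φ : S →ₐ[R] T) (z : S ⊗[R] (ι →₀ R)) (i : ι) :
    TensorProduct.finsuppScalarRight R T T ι (LinearMap.rTensor _ φ.toLinearMap z) i =
      φ (TensorProduct.finsuppScalarRight R S S ι z i) := by
  induction z using TensorProduct.induction_on with
  | zero => simp
  | tmul s f => simp [TensorProduct.finsuppScalarRight_apply_tmul_apply]
  | add x y hx hy => simp only [map_add, Finsupp.add_apply, hx, hy]

/-- A quotient of `M` that is naturally isomorphic to a free module is quasi-coherent. -/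
lemma isQuasiCoherent_quot_of_free {M : ModFunctor.{u, w} R} {ι : Type u} (K : Sub M)
    (r : (S : Type u) → [CommRing S] → [Algebra R S] → M.obj S →ₗ[S] (ι →₀ S))
    (hr : ∀ {S T : Type u} [CommRing S] [Algebra R S] [CommRing T] [Algebra R T]
      (φ : S →ₐ[R] T) (x : M.obj S) (i : ι), r T (M.map φ x) i = φ (r S x i))
    (hsurj : ∀ (S : Type u) [CommRing S] [Algebra R S], Function.Surjective (r S))
    (hker : ∀ (S : Type u) [CommRing S] [Algebra R S], K.obj S = LinearMap.ker (r S)) :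
    (M.quot K).IsQuasiCoherent := by
  classical
  let e (S : Type u) [CommRing S] [Algebra R S] : (M.obj S ⧸ K.obj S) ≃ₗ[S] (ι →₀ S) :=
    (Submodule.quotEquivOfEq _ _ (hker S)).trans ((r S).quotKerEquivOfSurjective (hsurj S))
  have he {S T : Type u} [CommRing S] [Algebra R S] [CommRing T] [Algebra R T] (φ : S →ₐ[R] T)
      (q : M.obj S ⧸ K.obj S) (i : ι) : e T ((M.quot K).map φ q) i = φ (e S q i) := by
    induction q using Submodule.Quotient.induction_on with
    | H x => exact hr φ x i
  refine ⟨ι →₀ R, inferInstance, inferInstance,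
    { app := fun S _ _ =>
        ((TensorProduct.finsuppScalarRight R S S ι).trans (e S).symm).toLinearMap
      naturality := fun {S T} _ _ _ _ φ z => ?_ }, fun S _ _ => LinearEquiv.bijective _⟩
  refine (e T).injective (Finsupp.ext fun i => ?_)
  refine Eq.trans ?_ (he φ _ i).symm
  change e T ((e T).symm _) i = φ (e S ((e S).symm _) i)
  rw [LinearEquiv.apply_symm_apply, LinearEquiv.apply_symm_apply]
  exact finsuppScalarRight_rTensor φ z i

namespace Coordinates

variable {M : ModFunctor.{u, w} R} {I : Type u} {P : Set (Set I)} (c : Coordinates M I P)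

variable {c} in
/-- The quasi-coherent quotient of `M` given by an admissible set of coordinates. -/
def Admissible.qcQuotient {γ : Set I} (hγ : c.Admissible γ) : QCQuotient M :=
  ⟨c.vanishing γ, isQuasiCoherent_quot_of_free _ (fun S _ _ => hγ.restrict S)
    (fun φ x i => c.coord_map φ x i) (fun S _ _ => hγ.restrict_surjective S)
    (fun S _ _ => hγ.ker_restrict S)⟩

/-- The quotients given by admissible sets of coordinates are cofinal among all quasi-coherent
quotients. -/
theorem exists_admissible_le (K : QCQuotient M) :
    ∃ (γ : Set I) (hγ : c.Admissible γ), hγ.qcQuotient ≤ K := by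
  -- The projection `M → M / K`, seen as a homomorphism over the base `R`.
  let g : IHom M (M.quot K.1) R :=
    { app := fun T _ _ _ => (K.1.obj T).mkQ
      naturality := fun _ _ _ => rfl }
  obtain ⟨γ, hγ, h⟩ := c.exists_admissible_app_eq_zero K.2.finitary g
  exact ⟨γ, hγ, fun S _ _ x hx =>
    (Submodule.Quotient.mk_eq_zero _).1 (h S (Algebra.ofId R S) x hx)⟩

include c in
theorem isCofiltered : IsCofiltered (QCQuotient M) := by
  have : Nonempty (QCQuotient M) := ⟨(c.admissible_of_finite Set.finite_empty).qcQuotient⟩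
  have : IsCodirectedOrder (QCQuotient M) := ⟨fun K L => by
    obtain ⟨γ, hγ, hK⟩ := c.exists_admissible_le K
    obtain ⟨δ, hδ, hL⟩ := c.exists_admissible_le L
    exact ⟨(hγ.union hδ).qcQuotient,
      le_trans (c.vanishing_anti Set.subset_union_left : _ ≤ hγ.qcQuotient.1) hK,
      le_trans (c.vanishing_anti Set.subset_union_right : _ ≤ hδ.qcQuotient.1) hL⟩⟩
  infer_instance

/-! ### The functor as the limit of its quasi-coherent quotients -/

section Limit

variable {S : Type u} [CommRing S] [Algebra R S]

include c in
-- Singletons are admissible, and the corresponding quotients detect the individual coordinates.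
lemma eq_of_forall_mkQ_eq {x y : M.obj S}
    (h : ∀ K : QCQuotient M, (K.1.obj S).mkQ x = (K.1.obj S).mkQ y) : x = y := by
  refine c.injective S (funext fun i => sub_eq_zero.1 ?_)
  have hi := (Submodule.Quotient.eq _).1
    (h (c.admissible_of_finite (Set.finite_singleton i)).qcQuotient) i rfl
  rwa [map_sub] at hi

include c in
-- The `i`-th coordinate of `y` is read off in the quotient attached to `{i}`. On `α ∈ P` it agrees
-- with a lift from the quotient attached to `α`, so the support of `y` there is finite.
lemma exists_forall_mkQ_eq (q : ∀ K : QCQuotient M, M.obj S ⧸ K.1.obj S)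
    (hq : ∀ (K L : QCQuotient M) (h : K ≤ L),
      Submodule.mapQ (K.1.obj S) (L.1.obj S) LinearMap.id (h S) (q K) = q L) :
    ∃ y : M.obj S, ∀ K : QCQuotient M, (K.1.obj S).mkQ y = q K := by
  choose v hv using fun K : QCQuotient M => (K.1.obj S).mkQ_surjective (q K)
  have hvv (K L : QCQuotient M) (h : K ≤ L) : v K - v L ∈ L.1.obj S := by
    rw [← Submodule.Quotient.eq]
    exact (congrArg (Submodule.mapQ (K.1.obj S) (L.1.obj S) LinearMap.id (h S)) (hv K)).trans
      ((hq K L h).trans (hv L).symm)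
  let pt (i : I) : QCQuotient M := (c.admissible_of_finite (Set.finite_singleton i)).qcQuotient
  have hpt {γ : Set I} (hγ : c.Admissible γ) (i : I) (hi : i ∈ γ) :
      c.coord S (v hγ.qcQuotient) i = c.coord S (v (pt i)) i := by
    have h := hvv hγ.qcQuotient (pt i)
      (c.vanishing_anti (Set.singleton_subset_iff.2 hi)) i rfl
    rwa [map_sub, Pi.sub_apply, sub_eq_zero] at h
  obtain ⟨y, hy⟩ := c.exists_coord_eq (fun i => c.coord S (v (pt i)) i) fun α hα =>
    (c.finite (v (c.admissible_of_mem hα).qcQuotient) α hα).subset fun i hi =>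
      ⟨hi.1, fun h => hi.2 ((hpt (c.admissible_of_mem hα) i hi.1).symm.trans h)⟩
  refine ⟨y, fun K => ?_⟩
  obtain ⟨γ, hγ, hle⟩ := c.exists_admissible_le K
  rw [← hv K]
  refine (Submodule.Quotient.eq _).2 ?_
  -- The two elements agree on `γ`, and the elements vanishing on `γ` lie in `K`.
  have h₁ : y - v hγ.qcQuotient ∈ K.1.obj S := hle S fun i hi => by
    rw [map_sub, Pi.sub_apply, hpt hγ i hi, hy, sub_self]
  have h₂ := hvv _ _ hle
  simpa using add_mem h₁ h₂

end Limit

include c in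
theorem nonempty_isLimit_quotCone : Nonempty (IsLimit M.quotCone) := by
  refine ⟨IsLimit.ofExistsUnique fun s => ?_⟩
  have hex (S : Type u) [CommRing S] [Algebra R S] (z : s.pt.obj S) :=
    c.exists_forall_mkQ_eq (fun K => (s.π.app K).app S z) fun K L h =>
      congrArg (fun f : Hom s.pt (M.quot L.1) => f.app S z) (s.w (homOfLE h))
  choose y hy using hex
  let d : Hom s.pt M :=
    { app := fun S _ _ =>
        { toFun := y S
          map_add' := fun a b => c.eq_of_forall_mkQ_eq fun K => by
            rw [map_add, hy, hy, hy, map_add]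
            rfl
          map_smul' := fun t a => c.eq_of_forall_mkQ_eq fun K => by
            rw [RingHom.id_apply, map_smul, hy, hy, map_smul]
            rfl }
      naturality := fun {S T} _ _ _ _ φ z => c.eq_of_forall_mkQ_eq fun K =>
        (hy T (s.pt.map φ z) K).trans (((s.π.app K).naturality φ z).trans
          (congrArg ((M.quot K.1).map φ) (hy S z K).symm)) }
  refine ⟨d, fun K => ?_, fun f hf => ?_⟩
  · refine Hom.ext ?_
    funext S _ _
    exact LinearMap.ext fun z => hy S z K
  · refine Hom.ext ?_
    funext S _ _
    refine LinearMap.ext fun z => c.eq_of_forall_mkQ_eq fun K => ?_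
    exact (congrArg (fun f : Hom s.pt (M.quot K.1) => f.app S z) (hf K)).trans (hy S z K).symm

end Coordinates

/-! ### The dual as the colimit of the duals of the quasi-coherent quotients -/

section Dual

variable {M : ModFunctor.{u, w} R}

/-- The dual `(M / K)^* → M^*` of the projection `M → M / K`. -/
def dualProj (K : QCQuotient M) : Hom (dual (M.quot K.1)) (dual M) :=
  (dualFunctor R).map (M.quotCone.π.app K).op

/-- The dual `(M / L)^* → (M / K)^*` of the projection `M / K → M / L`. -/
def dualTransition {K L : QCQuotient M} (h : K ≤ L) :
    Hom (dual (M.quot L.1)) (dual (M.quot K.1)) :=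
  (dualFunctor R).map (M.quotSystem.map (homOfLE h)).op

variable {S : Type u} [CommRing S] [Algebra R S]

lemma dualProj_injective (K : QCQuotient M) : Function.Injective ((dualProj K).app S) := by
  intro g g' h
  refine IHom.ext ?_
  funext T _ _ φ
  refine LinearMap.ext fun q => ?_
  obtain ⟨x, rfl⟩ := (K.1.obj T).mkQ_surjective q
  exact congrArg (fun f : IHom M (ring R) S => f.app T φ x) h

lemma exists_dualProj_eq (K : QCQuotient M) (g : (dual M).obj S)
    (hg : ∀ (T : Type u) [CommRing T] [Algebra R T] (φ : S →ₐ[R] T), ∀ x ∈ K.1.obj T,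
      IHom.app g T φ x = 0) :
    ∃ g', (dualProj K).app S g' = g := by
  let g' : IHom (M.quot K.1) (ring R) S :=
    { app := fun T _ _ φ => (K.1.obj T).liftQ (IHom.app g T φ) (fun x hx => hg T φ x hx)
      naturality := fun {T T'} _ _ _ _ φ ψ q => by
        obtain ⟨x, rfl⟩ := (K.1.obj T).mkQ_surjective q
        exact IHom.naturality g φ ψ x }
  refine ⟨g', IHom.ext ?_⟩
  funext T _ _ φ
  exact LinearMap.ext fun x => rfl

/-- Both functionals pull back to a common quotient above `M / K` and `M / L`, where they coincide
because its dual embeds in `M^*`. This makes the map out of `M^*` well defined. -/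
lemma cocone_ι_eq [IsCofiltered (QCQuotient M)]
    (s : Cocone (M.quotSystem.op ⋙ dualFunctor R)) {K L : QCQuotient M}
    (g : (dual (M.quot K.1)).obj S) (g' : (dual (M.quot L.1)).obj S)
    (h : (dualProj K).app S g = (dualProj L).app S g') :
    (s.ι.app (.op K)).app S g = (s.ι.app (.op L)).app S g' := by
  have hs {K L : QCQuotient M} (h : K ≤ L) (g : (dual (M.quot L.1)).obj S) :
      (s.ι.app (.op K)).app S ((dualTransition h).app S g) = (s.ι.app (.op L)).app S g :=
    congrArg (fun f : Hom (dual (M.quot L.1)) s.pt => f.app S g) (s.w (homOfLE h).op)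
  have hK := leOfHom (IsCofiltered.minToLeft K L)
  have hL := leOfHom (IsCofiltered.minToRight K L)
  rw [← hs hK, ← hs hL]
  exact congrArg _ (dualProj_injective _ h)

end Dual

namespace Coordinates

variable {M : ModFunctor.{u, w} R} {I : Type u} {P : Set (Set I)} (c : Coordinates M I P)

include c in
/-- Every element of the dual of `M` comes from a quasi-coherent quotient. -/
lemma exists_qcQuotient_dualProj_eq {S : Type u} [CommRing S] [Algebra R S]
    (g : (dual M).obj S) :
    ∃ (K : QCQuotient M) (g' : (dual (M.quot K.1)).obj S), (dualProj K).app S g' = g := by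
  obtain ⟨γ, hγ, h⟩ := c.exists_admissible_app_eq_zero (finitary_ring R) g
  exact ⟨hγ.qcQuotient, exists_dualProj_eq _ g h⟩

include c in
-- A common quotient for two functionals is needed for additivity of the map out of `M^*`.
lemma exists_qcQuotient_dualProj_eq₂ {S : Type u} [CommRing S] [Algebra R S]
    (a b : (dual M).obj S) :
    ∃ (K : QCQuotient M) (a' b' : (dual (M.quot K.1)).obj S),
      (dualProj K).app S a' = a ∧ (dualProj K).app S b' = b := by
  have := c.isCofiltered
  obtain ⟨K, a', rfl⟩ := c.exists_qcQuotient_dualProj_eq a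
  obtain ⟨L, b', rfl⟩ := c.exists_qcQuotient_dualProj_eq b
  exact ⟨IsCofiltered.min K L,
    (dualTransition (leOfHom (IsCofiltered.minToLeft K L))).app S a',
    (dualTransition (leOfHom (IsCofiltered.minToRight K L))).app S b', rfl, rfl⟩

include c in
theorem nonempty_isColimit_dual :
    Nonempty (IsColimit ((dualFunctor R).mapCocone M.quotCone.op)) := by
  have := c.isCofiltered
  refine ⟨IsColimit.ofExistsUnique fun s => ?_⟩
  have hex (S : Type u) [CommRing S] [Algebra R S] (g : (dual M).obj S) :
      ∃ y : s.pt.obj S, ∀ (K : QCQuotient M) (g' : (dual (M.quot K.1)).obj S),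
        (dualProj K).app S g' = g → (s.ι.app (.op K)).app S g' = y := by
    obtain ⟨K, g', rfl⟩ := c.exists_qcQuotient_dualProj_eq g
    exact ⟨(s.ι.app (.op K)).app S g', fun L g'' h => cocone_ι_eq s g'' g' h⟩
  choose y hy using hex
  let d : Hom (dual M) s.pt :=
    { app := fun S _ _ =>
        { toFun := y S
          map_add' := fun a b => by
            obtain ⟨K, a', b', rfl, rfl⟩ := c.exists_qcQuotient_dualProj_eq₂ a b
            rw [← hy S _ K a' rfl, ← hy S _ K b' rfl,
              ← hy S _ K (a' + b') (map_add ((dualProj K).app S) a' b')]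
            exact map_add ((s.ι.app (.op K)).app S) a' b'
          map_smul' := fun t a => by
            obtain ⟨K, a', rfl⟩ := c.exists_qcQuotient_dualProj_eq a
            rw [← hy S _ K a' rfl,
              ← hy S _ K (t • a') (map_smul ((dualProj K).app S) t a')]
            exact map_smul ((s.ι.app (.op K)).app S) t a' }
      naturality := fun {S T} _ _ _ _ φ a => by
        obtain ⟨K, a', rfl⟩ := c.exists_qcQuotient_dualProj_eq a
        change y T _ = s.pt.map φ (y S _)
        rw [← hy S _ K a' rfl,
          ← hy T _ K ((dual (M.quot K.1)).map φ a') ((dualProj K).naturality φ a')]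
        exact (s.ι.app (.op K)).naturality φ a' }
  refine ⟨d, fun K => ?_, fun f hf => ?_⟩
  · refine Hom.ext ?_
    funext S _ _
    exact LinearMap.ext fun g => (hy S _ K.unop g rfl).symm
  · refine Hom.ext ?_
    funext S _ _
    refine LinearMap.ext fun g => ?_
    obtain ⟨K, g', rfl⟩ := c.exists_qcQuotient_dualProj_eq g
    exact (congrArg (fun f : Hom (dual (M.quot K.1)) s.pt => f.app S g') (hf (.op K))).trans
      (hy S _ K g' rfl)

/-! ### Pro-quasicoherence -/

/-- The inclusion of the quotients given by admissible sets of coordinates into all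
quasi-coherent quotients. -/
def admissibleFunctor : {γ : Set I // c.Admissible γ}ᵒᵈ ⥤ QCQuotient M :=
  -- Enlarging `γ` shrinks the kernel, hence the order dual.
  Monotone.functor (f := fun γ => (OrderDual.ofDual γ).2.qcQuotient)
    fun _ _ h => c.vanishing_anti h

lemma isCofiltered_admissible : IsCofiltered {γ : Set I // c.Admissible γ}ᵒᵈ := by
  have : Nonempty {γ : Set I // c.Admissible γ}ᵒᵈ :=
    ⟨OrderDual.toDual ⟨∅, c.admissible_of_finite Set.finite_empty⟩⟩
  have : IsCodirectedOrder {γ : Set I // c.Admissible γ}ᵒᵈ :=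
    ⟨fun γ δ => ⟨OrderDual.toDual ⟨_, (OrderDual.ofDual γ).2.union (OrderDual.ofDual δ).2⟩,
      Set.subset_union_left, Set.subset_union_right⟩⟩
  infer_instance

/-- This is cofinality of the admissible quotients. It replaces the large poset of all
quasi-coherent quotients by a poset in `Type u`, as pro-quasicoherence demands. -/
lemma initial_admissibleFunctor : c.admissibleFunctor.Initial := by
  have := c.isCofiltered_admissible
  refine Functor.initial_of_exists_of_isCofiltered _ (fun K => ?_)
    fun {_ γ} _ _ => ⟨γ, 𝟙 γ, Subsingleton.elim _ _⟩
  obtain ⟨γ, hγ, h⟩ := c.exists_admissible_le K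
  exact ⟨OrderDual.toDual ⟨γ, hγ⟩, ⟨homOfLE h⟩⟩

end Coordinates

end ModFunctor

theorem mainTheorem4 {R : Type u} [CommRing R] (M : ModFunctor.{u, w} R)
    (hM : M.IsEssentiallyFree) :
    IsCofiltered M.QCQuotient ∧
      Nonempty (IsColimit ((ModFunctor.dualFunctor R).mapCocone M.quotCone.op)) ∧
      Nonempty (IsLimit M.quotCone) ∧
      M.IsProQuasicoherent := by
  obtain ⟨I, P, hP, f, hf⟩ := hM
  let c₀ := ModFunctor.limFreeCoordinates R P hP
  let c := c₀.ofIsIsomorphism f hf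
  refine ⟨c.isCofiltered, c.nonempty_isColimit_dual, c.nonempty_isLimit_quotCone, ?_⟩
  -- The limit is taken for `limFree R P` rather than `M`, because the inverse system must have
  -- values in `Type u`; `f` then transfers it to `M`.
  obtain ⟨h⟩ := c₀.nonempty_isLimit_quotCone
  have := c₀.initial_admissibleFunctor
  exact ⟨_, inferInstance, c₀.isCofiltered_admissible,
    c₀.admissibleFunctor ⋙ (ModFunctor.limFree R P).quotSystem,
    (ModFunctor.limFree R P).quotCone.whisker c₀.admissibleFunctor,
    fun γ => (c₀.admissibleFunctor.obj γ).2,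
    ⟨(Functor.Initial.isLimitWhiskerEquiv c₀.admissibleFunctor _).symm h⟩, f, hf⟩
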